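/- Corollary 3.8 (label Prop:ES). Let $q,d$ be natural numbers, $\alpha>1$, and let $V=(V_1,\dots,V_d)^\top$ be a random vector of nonnegative claims with Pareto-tails: for some $K_1,\dots,K_d>0$, $$P(V_j>t)\sim K_j t^{-\alpha}\quad (t\to\infty),\qquad j=1,\dots,d,$$ where $f\sim g$ means $f/g\to1$. Let $A=(A_{ij})$ be the random $q\times d$ weighted adjacency matrix $A_{ij}=\mathbf 1(i\sim j)\,W_{ij}$ of a random bipartite graph between agents $1,\dots,q$ and objects $1,\dots,d$, where the weights $W_{ij}\ge0$ may be random and coupled to the graph. The joint law of the edges may be arbitrary; in particular they may be independent with probabilities $p_{ij}\in[0,1]$. Assume that $A$ is independent of $V$ and that $\mathbb E A_{ij}^{\alpha}<\infty$ for all $i,j$. Let $F=AV$ be the vector of the agents' exposures, and let $\|\cdot\|$ be a norm on $\mathbb R^q$ under which all canonical unit vectors have norm 1. Assume that $V$ is multivariate regularly varying with exponent measure $\nu$: $\nu$ is a nonzero Radon measure on $[0,\infty]^d\setminus\{0\}$ without mass on points with an infinite coordinate, and $n\,P(n^{-1/\alpha}V\in\cdot)\to\nu$ vaguely as $n\to\infty$,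 i.e. on all continuous functions with compact support in $[0,\infty]^d\setminus\{0\}$. The claims are called asymptotically independent if $\nu$ has mass only on the coordinate axes, and asymptotically fully dependent if $\nu$ has mass only on the ray $\{s(K_1^{1/\alpha},\dots,K_d^{1/\alpha})^\top: s>0\}$. For $\gamma\in(0,1)$ let $$\mathrm{VaR}_{1-\gamma}(X)=\inf\{t\ge0: P(X>t)\le\gamma\},\qquad \mathrm{CoTE}_{1-\gamma}(X)=\mathbb E[X\mid X>\mathrm{VaR}_{1-\gamma}(X)],$$ and, with $K^{1/\alpha}=\mathrm{diag}(K_1^{1/\alpha},\dots,K_d^{1/\alpha})$, $\mathbf 1=(1,\dots,1)^\top\in\mathbb R^d$ and $e_j$ the unit vectors of $\mathbb R^d$, $$C^i_{ind}=\sum_{j=1}^dK_j\,\mathbb E A_{ij}^\alpha,\quad C^S_{ind}=\sum_{j=1}^dK_j\,\mathbb E\|Ae_j\|^\alpha,\quad C^i_{dep}=\mathbb E\big((AK^{1/\alpha}\mathbf 1)_i\big)^\alpha,\quad C^S_{dep}=\mathbb E\|AK^{1/\alpha}\mathbf 1\|^\alpha .$$ Then the following hold. (1) For every agent $i\in\{1,\dots,q\}$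 with $P(A_{ij}>0\text{ for some }j)>0$, $$\mathrm{CoTE}_{1-\gamma}(F_i)\sim\frac{\alpha}{\alpha-1}\,\mathrm{VaR}_{1-\gamma}(F_i)\sim\frac{\alpha}{\alpha-1}\,C^{1/\alpha}\gamma^{-1/\alpha}\qquad(\gamma\downarrow0),$$ with $C=C^i_{ind}$ if $V_1,\dots,V_d$ are asymptotically independent, and $C=C^i_{dep}$ if they are asymptotically fully dependent. (2) If $P(A_{ij}>0\text{ for some }i,j)>0$, then $$\mathrm{CoTE}_{1-\gamma}(\|F\|)\sim\frac{\alpha}{\alpha-1}\,\mathrm{VaR}_{1-\gamma}(\|F\|)\sim\frac{\alpha}{\alpha-1}\,C^{1/\alpha}\gamma^{-1/\alpha}\qquad(\gamma\downarrow0),$$ with $C=C^S_{ind}$ if $V_1,\dots,V_d$ are asymptotically independent, and $C=C^S_{dep}$ if they are asymptotically fully dependent. -/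

import Mathlib

open MeasureTheory ProbabilityTheory Filter Topology
open scoped ENNReal

noncomputable section

namespace InsuranceMarket

/-- `f ∼ g` along the filter `l`, in the sense that `f / g → 1`. A quotient with denominator `0` is
`0` in Lean, so this forces `f` and `g` to be eventually nonzero. -/
def AsympEq {X : Type*} (l : Filter X) (f g : X → ℝ) : Prop :=
  Tendsto (fun x => f x / g x) l (𝓝 1)

/-- The space `[0,∞]^d` without the origin, with the subspace topology: its compact sets are the
compact subsets of `[0,∞]^d` that do not contain the origin. -/
abbrev PuncturedOrthant (d : ℕ) : Type := ({0}ᶜ : Set (Fin d → ℝ≥0∞))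

/-- Vague convergence of measures on the punctured orthant: convergence of the integrals of all
continuous functions with compact support. -/
def VagueTendsto {d : ℕ} (νs : ℕ → Measure (PuncturedOrthant d))
    (ν : Measure (PuncturedOrthant d)) : Prop :=
  ∀ f : PuncturedOrthant d → ℝ, Continuous f → HasCompactSupport f →
    Tendsto (fun n => ∫ x, f x ∂(νs n)) atTop (𝓝 (∫ x, f x ∂ν))

/-- The measure `n P(V / bₙ ∈ ·)` on the punctured orthant, for a nonnegative random vector `V`. -/
def scaledLaw {Ω : Type*} [MeasurableSpace Ω] {d : ℕ} (P : Measure Ω) (V : Ω → Fin d → ℝ)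
    (b : ℕ → ℝ) (n : ℕ) : Measure (PuncturedOrthant d) :=
  (n : ℝ≥0∞) •
    (P.map (fun ω (j : Fin d) => ENNReal.ofReal (V ω j / b n))).comap
      (Subtype.val : PuncturedOrthant d → Fin d → ℝ≥0∞)

/-- `V` is multivariate regularly varying with normalizing sequence `b` and exponent measure `ν`:
`ν` is a nonzero Radon measure on the punctured orthant without mass at infinity, and
`n P(V / bₙ ∈ ·)` converges vaguely to `ν`. -/
structure IsExponentMeasure {Ω : Type*} [MeasurableSpace Ω] {d : ℕ} (P : Measure Ω)
    (V : Ω → Fin d → ℝ) (b : ℕ → ℝ) (ν : Measure (PuncturedOrthant d)) : Prop where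
  scale_tendsto : Tendsto b atTop atTop
  finite_on_compacts : IsFiniteMeasureOnCompacts ν
  ne_zero : ν ≠ 0
  no_mass_at_infinity : ν {x | ∃ j, x.1 j = ∞} = 0
  vague : VagueTendsto (scaledLaw P V b) ν

/-- Asymptotic independence: the exponent measure has mass only on the coordinate axes. -/
def ConcentratedOnAxes {d : ℕ} (ν : Measure (PuncturedOrthant d)) : Prop :=
  ν {x : PuncturedOrthant d | ∃ j, ∀ k, k ≠ j → x.1 k = 0}ᶜ = 0

/-- Asymptotic full dependence: the exponent measure has mass only on the ray
`{s (K₁^{1/α}, …, K_d^{1/α}) : s > 0}`. -/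
def ConcentratedOnRay {d : ℕ} (α : ℝ) (K : Fin d → ℝ) (ν : Measure (PuncturedOrthant d)) : Prop :=
  ν {x : PuncturedOrthant d |
    ∃ s : ℝ, 0 < s ∧ ∀ j, x.1 j = ENNReal.ofReal (s * K j ^ (1 / α))}ᶜ = 0

/-- Weighted adjacency matrix `A_{ij} = 1(i ∼ j) W_{ij}` of the random bipartite graph; `G i j` is
the event `i ∼ j` that agent `i` is linked to object `j`, and `W i j` is the random weight. -/
def adjMatrix {Ω : Type*} {q d : ℕ} (G : Fin q → Fin d → Set Ω) (W : Fin q → Fin d → Ω → ℝ)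
    (ω : Ω) : Matrix (Fin q) (Fin d) ℝ :=
  Matrix.of fun i j => (G i j).indicator (W i j) ω

/-- The vector of exposures `F = A V`. -/
def exposure {Ω : Type*} {q d : ℕ} (A : Ω → Matrix (Fin q) (Fin d) ℝ) (V : Ω → Fin d → ℝ)
    (ω : Ω) : Fin q → ℝ :=
  (A ω).mulVec (V ω)

/-- Value-at-Risk at level `1 - γ`: `inf {t ≥ 0 : P(X > t) ≤ γ}`. -/
def VaR {Ω : Type*} [MeasurableSpace Ω] (P : Measure Ω) (X : Ω → ℝ) (γ : ℝ) : ℝ :=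
  sInf {t : ℝ | 0 ≤ t ∧ P.real {ω | t < X ω} ≤ γ}

/-- Conditional Tail Expectation at level `1 - γ`: `E[X | X > VaR_{1-γ}(X)]`. -/
def CoTE {Ω : Type*} [MeasurableSpace Ω] (P : Measure Ω) (X : Ω → ℝ) (γ : ℝ) : ℝ :=
  ∫ ω, X ω ∂(P[|{ω | VaR P X γ < X ω}])

/-- `C^i_ind = ∑_j K_j E A_{ij}^α`. -/
def CIndAgent {Ω : Type*} [MeasurableSpace Ω] {q d : ℕ} (P : Measure Ω) (α : ℝ) (K : Fin d → ℝ)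
    (A : Ω → Matrix (Fin q) (Fin d) ℝ) (i : Fin q) : ℝ :=
  ∑ j, K j * ∫ ω, A ω i j ^ α ∂P

/-- `C^S_ind = ∑_j K_j E ‖A e_j‖^α`. -/
def CIndSystem {Ω : Type*} [MeasurableSpace Ω] {q d : ℕ} (P : Measure Ω) (α : ℝ) (K : Fin d → ℝ)
    (N : Seminorm ℝ (Fin q → ℝ)) (A : Ω → Matrix (Fin q) (Fin d) ℝ) : ℝ :=
  ∑ j, K j * ∫ ω, N ((A ω).mulVec (Pi.single j 1)) ^ α ∂P

/-- The random vector `A K^{1/α} 1`, where `K^{1/α} = diag(K₁^{1/α}, …, K_d^{1/α})`. -/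
def fullLoad {Ω : Type*} {q d : ℕ} (α : ℝ) (K : Fin d → ℝ) (A : Ω → Matrix (Fin q) (Fin d) ℝ)
    (ω : Ω) : Fin q → ℝ :=
  (A ω * Matrix.diagonal (fun j => K j ^ (1 / α))).mulVec 1

/-- `C^i_dep = E (A K^{1/α} 1)_i^α`. -/
def CDepAgent {Ω : Type*} [MeasurableSpace Ω] {q d : ℕ} (P : Measure Ω) (α : ℝ) (K : Fin d → ℝ)
    (A : Ω → Matrix (Fin q) (Fin d) ℝ) (i : Fin q) : ℝ :=
  ∫ ω, fullLoad α K A ω i ^ α ∂P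

/-- `C^S_dep = E ‖A K^{1/α} 1‖^α`. -/
def CDepSystem {Ω : Type*} [MeasurableSpace Ω] {q d : ℕ} (P : Measure Ω) (α : ℝ) (K : Fin d → ℝ)
    (N : Seminorm ℝ (Fin q → ℝ)) (A : Ω → Matrix (Fin q) (Fin d) ℝ) : ℝ :=
  ∫ ω, N (fullLoad α K A ω) ^ α ∂P

/-- As `γ ↓ 0`,
`CoTE_{1-γ}(X) ∼ α/(α-1) VaR_{1-γ}(X) ∼ α/(α-1) C^{1/α} γ^{-1/α}`. -/
def TailRiskAsymptotics {Ω : Type*} [MeasurableSpace Ω] (P : Measure Ω) (α : ℝ) (X : Ω → ℝ)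
    (C : ℝ) : Prop :=
  AsympEq (𝓝[>] 0) (fun γ : ℝ => CoTE P X γ) (fun γ => α / (α - 1) * VaR P X γ) ∧
  AsympEq (𝓝[>] 0) (fun γ : ℝ => α / (α - 1) * VaR P X γ)
    (fun γ => α / (α - 1) * C ^ (1 / α) * γ ^ (-(1 / α)))

end InsuranceMarket

end

/-!
The tail of an aggregated exposure is computed by conditioning on the network. For a fixed matrix
`a`, the exposure `N (a V)` is a seminorm `ψ` of the claims `V`, and for every seminorm
`t ^ α * P (ψ V > t)` converges to

* `∑ j, K j * ψ (e j) ^ α` under asymptotic independence (`ConcentratedOnAxes.seminorm_tail`): two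
  claims are never large simultaneously, so `ψ V` differs negligibly from `∑ j, ψ (e j) * V j`, and
  inclusion–exclusion adds up the tails of the summands (`HasParetoTail.sum_of_min`);
* `ψ k ^ α` with `k j = K j ^ (1 / α)` under asymptotic full dependence
  (`ConcentratedOnRay.seminorm_tail`): `V` differs negligibly from `(V i / k i) • k`.

Only the negligible parts need the exponent measure: a continuous function on the orthant that
vanishes near the origin and `ν`-almost everywhere is, by vague convergence, at least `1` at the
rescaled claims only with probability `o (1 / n)` (`IsExponentMeasure.tendsto_zero`). The Pareto
asymptotics of the single claims supply everything else.

Independence and dominated convergence then replace `ψ` by the random seminorm `v ↦ N (A v)` and the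
limit by its expectation (`hasParetoTail_seminorm_mulVec`); the dominating function is integrable by
the moment assumption. A single agent is covered by the seminorm `x ↦ |x i|`.

Finally, if `t ^ α * P (X > t) → C > 0`, then inverting the tail gives the Value-at-Risk
(`HasParetoTail.tendsto_VaR`), and integrating it gives the mean above a high level
(`HasParetoTail.tendsto_integral_cond`), which at the level `VaR` is the Conditional Tail
Expectation.
-/

namespace InsuranceMarket

/-! ### Pareto tails -/

section Tails

variable {Ω : Type*} [MeasurableSpace Ω] {P : Measure Ω} {α : ℝ}

/-- `X` has a Pareto tail with index `α` and constant `c`: `t ^ α * P (X > t) → c` as `t → ∞`.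
The constant may be `0`; then the upper tail of `X` is negligible on the scale `t ^ (-α)`. -/
def HasParetoTail (P : Measure Ω) (α : ℝ) (X : Ω → ℝ) (c : ℝ) : Prop :=
  Tendsto (fun t : ℝ => t ^ α * P.real {ω | t < X ω}) atTop (𝓝 c)

theorem HasParetoTail.const_mul (hα : 0 < α) {X : Ω → ℝ} {c s : ℝ} (hs : 0 ≤ s)
    (h : HasParetoTail P α X c) : HasParetoTail P α (fun ω => s * X ω) (s ^ α * c) := by
  unfold HasParetoTail at *
  rcases hs.eq_or_lt with rfl | hs
  · rw [Real.zero_rpow hα.ne', zero_mul]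
    refine tendsto_const_nhds.congr' ?_
    filter_upwards [eventually_ge_atTop 0] with t ht
    simp [not_lt.2 ht]
  · have h2 : Tendsto (fun t : ℝ => t / s) atTop atTop := tendsto_id.atTop_div_const hs
    refine ((h.comp h2).const_mul (s ^ α)).congr' ?_
    filter_upwards [eventually_ge_atTop 0] with t ht
    have hset : {ω | t / s < X ω} = {ω | t < s * X ω} := by
      ext ω
      simp only [Set.mem_ofPred_eq]
      rw [div_lt_iff₀ hs, mul_comm]
    simp only [Function.comp_apply, hset]
    rw [Real.div_rpow ht hs.le, ← mul_assoc, mul_div_cancel₀ _ (Real.rpow_pos_of_pos hs α).ne']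

theorem hasParetoTail_zero : HasParetoTail P α (fun _ => 0) 0 := by
  refine tendsto_const_nhds.congr' ?_
  filter_upwards [eventually_ge_atTop 0] with t ht
  simp [not_lt.2 ht]

/-- The tail bound holds for all `t > 0`, since small `t` are controlled by `P (X > t) ≤ 1`. -/
theorem HasParetoTail.exists_bound [IsProbabilityMeasure P] (hα : 0 < α) {X : Ω → ℝ} {c : ℝ}
    (h : HasParetoTail P α X c) :
    ∃ M : ℝ, 0 ≤ M ∧ ∀ t : ℝ, 0 < t → t ^ α * P.real {ω | t < X ω} ≤ M := by
  obtain ⟨T, hT⟩ := eventually_atTop.1 (h.eventually (gt_mem_nhds (lt_add_one c)))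
  refine ⟨max (c + 1) (max T 0 ^ α), le_max_of_le_right (by positivity), fun t ht => ?_⟩
  rcases le_total T t with h1 | h1
  · exact (hT t h1).le.trans (le_max_left _ _)
  · refine le_max_of_le_right ?_
    calc t ^ α * P.real {ω | t < X ω} ≤ t ^ α * 1 := by
          gcongr
          exact measureReal_le_one
      _ ≤ max T 0 ^ α := by
          rw [mul_one]
          gcongr
          exact h1.trans (le_max_left _ _)

variable [IsFiniteMeasure P]

theorem HasParetoTail.mono_zero {X Y : Ω → ℝ} (hY : HasParetoTail P α Y 0)
    (hXY : ∀ ω, X ω ≤ Y ω) : HasParetoTail P α X 0 := by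
  refine tendsto_of_tendsto_of_tendsto_of_le_of_le' tendsto_const_nhds hY ?_ ?_
  · filter_upwards [eventually_ge_atTop 0] with t ht
    positivity
  · filter_upwards [eventually_ge_atTop 0] with t ht
    gcongr ?_ * ?_
    exact measureReal_mono fun ω hω => lt_of_lt_of_le hω (hXY ω)

theorem HasParetoTail.add_zero (hα : 0 < α) {X Y : Ω → ℝ} (hX : HasParetoTail P α X 0)
    (hY : HasParetoTail P α Y 0) : HasParetoTail P α (fun ω => X ω + Y ω) 0 := by
  have hX2 := hX.const_mul hα zero_le_two
  have hY2 := hY.const_mul hα zero_le_two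
  have hsum := hX2.add hY2
  simp only [mul_zero, _root_.add_zero] at hsum
  refine tendsto_of_tendsto_of_tendsto_of_le_of_le' tendsto_const_nhds hsum ?_ ?_
  · filter_upwards [eventually_ge_atTop 0] with t ht
    positivity
  · filter_upwards [eventually_ge_atTop 0] with t ht
    rw [← mul_add]
    gcongr
    refine (measureReal_mono ?_).trans (measureReal_union_le _ _)
    intro ω hω
    simp only [Set.mem_ofPred_eq, Set.mem_union] at *
    by_contra! hcon
    linarith [hcon.1, hcon.2]

theorem HasParetoTail.sum_zero (hα : 0 < α) {ι : Type*} (s : Finset ι) {X : ι → Ω → ℝ}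
    (hX : ∀ i ∈ s, HasParetoTail P α (X i) 0) :
    HasParetoTail P α (fun ω => ∑ i ∈ s, X i ω) 0 := by
  classical
  induction s using Finset.induction_on with
  | empty => simpa using hasParetoTail_zero
  | insert i s hi ih =>
    simp only [Finset.sum_insert hi]
    exact (hX i (by simp)).add_zero hα (ih fun j hj => hX j (by simp [hj]))

/-- A Pareto tail is unchanged by a perturbation whose tail is negligible: for `s` close to `1`,
`X > t` forces `s Y > t` with `s > 1`, and follows from `s Y > t` with `s < 1`, unless the
perturbation exceeds a multiple of `t`. -/
theorem HasParetoTail.of_abs_sub_le (hα : 0 < α) {X Y R : Ω → ℝ} {c : ℝ}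
    (hY : HasParetoTail P α Y c) (hR : HasParetoTail P α R 0)
    (h : ∀ ω, |X ω - Y ω| ≤ R ω) : HasParetoTail P α X c := by
  have hcont : Tendsto (fun s : ℝ => s ^ α * c) (𝓝 1) (𝓝 c) := by
    have : ContinuousAt (fun s : ℝ => s ^ α * c) 1 :=
      (Real.continuousAt_rpow_const 1 α (Or.inl one_ne_zero)).mul continuousAt_const
    simpa [ContinuousAt] using this
  refine tendsto_order.2 ⟨fun a ha => ?_, fun a ha => ?_⟩
  · have h1 : ∀ᶠ s : ℝ in 𝓝[<] 1, a < s ^ α * c ∧ 0 < s ∧ s < 1 :=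
      ((hcont.eventually (lt_mem_nhds ha)).filter_mono nhdsWithin_le_nhds).and
        (((lt_mem_nhds one_pos).filter_mono nhdsWithin_le_nhds).and self_mem_nhdsWithin)
    obtain ⟨s, hs, hs0, hs1⟩ := h1.exists
    have hs1' : 0 < 1 - s := by linarith
    have hlim := (hY.const_mul hα hs0.le).sub (hR.const_mul hα (s := s / (1 - s)) (by positivity))
    rw [mul_zero, sub_zero] at hlim
    filter_upwards [hlim.eventually (lt_mem_nhds hs), eventually_ge_atTop 0] with t ht ht0
    refine ht.trans_le ?_
    rw [← mul_sub]
    gcongr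
    rw [sub_le_iff_le_add]
    refine (measureReal_mono ?_).trans (measureReal_union_le _ _)
    intro ω hω
    simp only [Set.mem_ofPred_eq, Set.mem_union] at *
    by_contra! hcon
    obtain ⟨hX, hr⟩ := hcon
    rw [div_mul_eq_mul_div, div_le_iff₀ hs1'] at hr
    have := (abs_le.1 (h ω)).1
    nlinarith
  · have h1 : ∀ᶠ s : ℝ in 𝓝[>] 1, s ^ α * c < a ∧ 1 < s :=
      ((hcont.eventually (gt_mem_nhds ha)).filter_mono nhdsWithin_le_nhds).and self_mem_nhdsWithin
    obtain ⟨s, hs, hs1⟩ := h1.exists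
    have hs0 : 0 < s := by linarith
    have hs1' : 0 < s - 1 := by linarith
    have hlim := (hY.const_mul hα hs0.le).add (hR.const_mul hα (s := s / (s - 1)) (by positivity))
    rw [mul_zero, _root_.add_zero] at hlim
    filter_upwards [hlim.eventually (gt_mem_nhds hs), eventually_ge_atTop 0] with t ht ht0
    refine lt_of_le_of_lt ?_ ht
    rw [← mul_add]
    gcongr
    refine (measureReal_mono ?_).trans (measureReal_union_le _ _)
    intro ω hω
    simp only [Set.mem_ofPred_eq, Set.mem_union] at *
    by_contra! hcon
    obtain ⟨hX, hr⟩ := hcon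
    rw [div_mul_eq_mul_div, div_le_iff₀ hs1'] at hr
    have := (abs_le.1 (h ω)).2
    nlinarith

/-- Negligibility of a tail may be tested along `t = n ^ (1 / α)`, since the tail is monotone and
`t ^ α` at most doubles between consecutive test points. -/
theorem hasParetoTail_zero_of_seq (hα : 0 < α) {R : Ω → ℝ}
    (h : Tendsto (fun n : ℕ => (n : ℝ) * P.real {ω | (n : ℝ) ^ (1 / α) < R ω}) atTop (𝓝 0)) :
    HasParetoTail P α R 0 := by
  have hfl : Tendsto (fun t : ℝ => ⌊t ^ α⌋₊) atTop atTop :=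
    tendsto_nat_floor_atTop.comp (tendsto_rpow_atTop hα)
  have h2 := (h.comp hfl).const_mul 2
  rw [mul_zero] at h2
  refine tendsto_of_tendsto_of_tendsto_of_le_of_le' tendsto_const_nhds h2 ?_ ?_
  · filter_upwards [eventually_ge_atTop 0] with t ht
    positivity
  · filter_upwards [eventually_ge_atTop 1] with t ht
    have ht0 : 0 ≤ t := by linarith
    have h1 : 1 ≤ t ^ α := Real.one_le_rpow ht hα.le
    have hn1 : (1 : ℝ) ≤ (⌊t ^ α⌋₊ : ℝ) := by
      exact_mod_cast (Nat.one_le_floor_iff (t ^ α)).2 h1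
    have hlt := Nat.lt_floor_add_one (t ^ α)
    have hle : (⌊t ^ α⌋₊ : ℝ) ^ (1 / α) ≤ t := by
      calc (⌊t ^ α⌋₊ : ℝ) ^ (1 / α) ≤ (t ^ α) ^ (1 / α) := by
            gcongr
            exact Nat.floor_le (by positivity)
        _ = t := by rw [← Real.rpow_mul ht0, mul_one_div_cancel hα.ne', Real.rpow_one]
    simp only [Function.comp_apply]
    rw [← mul_assoc]
    gcongr ?_ * ?_
    · linarith
    · exact measureReal_mono fun ω hω => lt_of_le_of_lt hle hω

/-- Inclusion–exclusion: `P (max X Y > t) = P (X > t) + P (Y > t) - P (min X Y > t)`, while `X + Y`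
differs from `max X Y` only by `min X Y`. -/
theorem HasParetoTail.add_of_min (hα : 0 < α) {X Y : Ω → ℝ} (hYm : Measurable Y)
    {a b : ℝ} (hX0 : ∀ ω, 0 ≤ X ω) (hY0 : ∀ ω, 0 ≤ Y ω) (hX : HasParetoTail P α X a)
    (hY : HasParetoTail P α Y b) (hXY : HasParetoTail P α (fun ω => min (X ω) (Y ω)) 0) :
    HasParetoTail P α (fun ω => X ω + Y ω) (a + b) := by
  have hmax : HasParetoTail P α (fun ω => max (X ω) (Y ω)) (a + b) := by
    have hlim := (hX.add hY).sub hXY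
    rw [sub_zero] at hlim
    refine hlim.congr fun t => ?_
    have hu : {ω | t < max (X ω) (Y ω)} = {ω | t < X ω} ∪ {ω | t < Y ω} := by
      ext; simp
    have hi : {ω | t < min (X ω) (Y ω)} = {ω | t < X ω} ∩ {ω | t < Y ω} := by
      ext; simp
    have := measureReal_union_add_inter (μ := P) (s := {ω | t < X ω})
      (measurableSet_lt measurable_const hYm : MeasurableSet {ω | t < Y ω})
    rw [hu, hi, ← mul_add, ← mul_sub, ← this, add_sub_cancel_right]
  refine hmax.of_abs_sub_le hα hXY fun ω => ?_
  rw [← max_add_min (X ω) (Y ω), add_sub_cancel_left, abs_of_nonneg (le_min (hX0 ω) (hY0 ω))]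

/-- The principle of a single big jump: the tail constants of nonnegative variables add up when no
two of them are large simultaneously. -/
theorem HasParetoTail.sum_of_min (hα : 0 < α) {ι : Type*} (s : Finset ι)
    {X : ι → Ω → ℝ} {c : ι → ℝ} (hXm : ∀ i, Measurable (X i)) (hX0 : ∀ i ω, 0 ≤ X i ω)
    (hX : ∀ i, HasParetoTail P α (X i) (c i))
    (hmin : ∀ i j, i ≠ j → HasParetoTail P α (fun ω => min (X i ω) (X j ω)) 0) :
    HasParetoTail P α (fun ω => ∑ i ∈ s, X i ω) (∑ i ∈ s, c i) := by
  classical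
  induction s using Finset.induction_on with
  | empty => simpa using hasParetoTail_zero
  | insert i s hi ih =>
    simp only [Finset.sum_insert hi]
    refine (hX i).add_of_min hα (Finset.measurable_fun_sum s fun j _ => hXm j) (hX0 i)
      (fun ω => Finset.sum_nonneg fun j _ => hX0 j ω) ih ?_
    refine (HasParetoTail.sum_zero hα s (X := fun j ω => min (X i ω) (X j ω)) fun j hj =>
      hmin i j fun h => hi (h ▸ hj)).mono_zero fun ω => ?_
    by_cases hex : ∃ j ∈ s, X i ω ≤ X j ω
    · obtain ⟨j, hj, hle⟩ := hex
      calc min (X i ω) (∑ j ∈ s, X j ω) ≤ min (X i ω) (X j ω) := by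
            rw [min_eq_left hle]
            exact min_le_left _ _
        _ ≤ _ := Finset.single_le_sum (f := fun j => min (X i ω) (X j ω))
            (fun k _ => le_min (hX0 i ω) (hX0 k ω)) hj
    · push Not at hex
      refine (min_le_right _ _).trans (Finset.sum_le_sum fun j hj => ?_)
      rw [min_eq_right (hex j hj).le]

end Tails

/-! ### Value-at-Risk and Conditional Tail Expectation -/

section RiskMeasures

variable {Ω : Type*} [MeasurableSpace Ω] {P : Measure Ω} {α : ℝ} {X : Ω → ℝ} {C : ℝ}

theorem tendsto_VaR_atTop (hα : 0 < α) (hC : 0 < C)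
    (h : Tendsto (fun γ : ℝ => γ ^ (1 / α) * VaR P X γ) (𝓝[>] 0) (𝓝 (C ^ (1 / α)))) :
    Tendsto (fun γ : ℝ => VaR P X γ) (𝓝[>] 0) atTop := by
  have h1 : Tendsto (fun γ : ℝ => (γ⁻¹) ^ (1 / α)) (𝓝[>] 0) atTop :=
    (tendsto_rpow_atTop (one_div_pos.2 hα)).comp tendsto_inv_nhdsGT_zero
  refine (h1.atTop_mul_pos (Real.rpow_pos_of_pos hC _) h).congr' ?_
  filter_upwards [self_mem_nhdsWithin] with γ hγ
  replace hγ : 0 < γ := hγ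
  rw [← mul_assoc, ← Real.mul_rpow (by positivity) hγ.le, inv_mul_cancel₀ hγ.ne', Real.one_rpow,
    one_mul]

theorem integral_add_rpow_Ioi (hα : 1 < α) {v : ℝ} (hv : 0 < v) :
    ∫ s in Set.Ioi (0 : ℝ), (s + v) ^ (-α) = v ^ (1 - α) / (α - 1) := by
  have h1 := (measurePreserving_add_right (volume : Measure ℝ) v).setIntegral_preimage_emb
    (measurableEmbedding_addRight v) (fun t => t ^ (-α)) (Set.Ioi v)
  have h2 : (fun s : ℝ => s + v) ⁻¹' Set.Ioi v = Set.Ioi 0 := by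
    ext s
    simp
  rw [h2, integral_Ioi_rpow_of_lt (by linarith) hv] at h1
  rw [h1, show -α + 1 = 1 - α by ring, show 1 - α = -(α - 1) by ring, neg_div_neg_eq]

variable [IsProbabilityMeasure P]

/-- The quantile is the generalized inverse of the tail, so that `c < t ^ α * P (X > t)` for
large `t` gives `c ^ (1 / α) ≤ γ ^ (1 / α) * VaR` for small `γ`, and likewise from above. -/
theorem HasParetoTail.tendsto_VaR (hα : 0 < α) (hC : 0 < C) (h : HasParetoTail P α X C) :
    Tendsto (fun γ : ℝ => γ ^ (1 / α) * VaR P X γ) (𝓝[>] 0) (𝓝 (C ^ (1 / α))) := by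
  have hβ : 0 < 1 / α := one_div_pos.2 hα
  have hpow : ∀ {y : ℝ}, 0 ≤ y → (y ^ (1 / α)) ^ α = y := fun hy => by
    rw [← Real.rpow_mul hy, one_div_mul_cancel hα.ne', Real.rpow_one]
  have hscale : ∀ c : ℝ, 0 < c →
      Tendsto (fun γ : ℝ => (c / γ) ^ (1 / α)) (𝓝[>] 0) atTop := by
    intro c hc
    refine (tendsto_rpow_atTop hβ).comp ?_
    exact (tendsto_inv_nhdsGT_zero.const_mul_atTop hc).congr fun γ => (div_eq_mul_inv c γ).symm
  have hroot : ∀ c γ : ℝ, 0 < c → 0 < γ → γ ^ (1 / α) * (c / γ) ^ (1 / α) = c ^ (1 / α) := by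
    intro c γ hc hγ
    rw [← Real.mul_rpow hγ.le (by positivity), mul_div_cancel₀ _ hγ.ne']
  have hupper : ∀ c : ℝ, C < c → ∀ᶠ γ : ℝ in 𝓝[>] 0,
      γ ^ (1 / α) * VaR P X γ ≤ c ^ (1 / α) := by
    intro c hc
    have hc0 : 0 < c := hC.trans hc
    filter_upwards [(hscale c hc0).eventually (h.eventually (gt_mem_nhds hc)),
      self_mem_nhdsWithin] with γ hγ hγ0
    replace hγ0 : 0 < γ := hγ0
    rw [hpow (by positivity), div_mul_eq_mul_div, div_lt_iff₀ hγ0] at hγ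
    rw [← hroot c γ hc0 hγ0]
    gcongr
    refine csInf_le ⟨0, fun _ h => h.1⟩ ⟨by positivity, ?_⟩
    exact (lt_of_mul_lt_mul_left hγ hc0.le).le
  have hlower : ∀ c : ℝ, 0 < c → c < C → ∀ᶠ γ : ℝ in 𝓝[>] 0,
      c ^ (1 / α) ≤ γ ^ (1 / α) * VaR P X γ := by
    intro c hc0 hc
    obtain ⟨T, hT⟩ := eventually_atTop.1 (h.eventually (lt_mem_nhds hc))
    filter_upwards [(hscale c hc0).eventually (eventually_gt_atTop (max T 0)),
      (hscale (2 * C) (by positivity)).eventually (h.eventually (gt_mem_nhds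
        (show C < 2 * C by linarith))),
      self_mem_nhdsWithin] with γ hγ hne hγ0
    replace hγ0 : 0 < γ := hγ0
    rw [← hroot c γ hc0 hγ0]
    gcongr
    -- The junk value `sInf ∅ = 0` does not occur: the tail falls below `γ` eventually.
    refine le_csInf ?_ fun t ht => ?_
    · refine ⟨(2 * C / γ) ^ (1 / α), by positivity, ?_⟩
      rw [hpow (by positivity), div_mul_eq_mul_div, div_lt_iff₀ hγ0] at hne
      exact (lt_of_mul_lt_mul_left hne (by positivity)).le
    · by_contra! hlt
      obtain ⟨ht0, hle⟩ := ht
      -- Any point strictly between `max t T` and `(c / γ) ^ (1 / α)` has tail above `γ`.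
      obtain ⟨s, hs1, hs2⟩ := exists_between (max_lt hlt hγ)
      have hts : t < s := (le_max_left _ _).trans_lt hs1
      have hTs : T < s := ((le_max_left _ _).trans (le_max_right _ _)).trans_lt hs1
      have hs0 : 0 < s := ht0.trans_lt hts
      have h1 : c < s ^ α * γ := by
        refine (hT s hTs.le).trans_le ?_
        gcongr
        exact (measureReal_mono fun ω hω => hts.trans hω).trans hle
      have h2 : s ^ α < c / γ := by
        have := Real.rpow_lt_rpow hs0.le hs2 hα
        rwa [hpow (by positivity)] at this
      rw [lt_div_iff₀ hγ0] at h2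
      exact lt_asymm h1 h2
  have hcont : ContinuousAt (fun c : ℝ => c ^ (1 / α)) C :=
    Real.continuousAt_rpow_const _ _ (Or.inl hC.ne')
  refine tendsto_order.2 ⟨fun a ha => ?_, fun a ha => ?_⟩
  · have h1 : ∀ᶠ c in 𝓝[<] C, a < c ^ (1 / α) ∧ 0 < c ∧ c < C :=
      ((hcont.eventually (lt_mem_nhds ha)).filter_mono nhdsWithin_le_nhds).and
        (((lt_mem_nhds hC).filter_mono nhdsWithin_le_nhds).and self_mem_nhdsWithin)
    obtain ⟨c, hca, hc0, hcC⟩ := h1.exists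
    filter_upwards [hlower c hc0 hcC] with γ hγ using hca.trans_le hγ
  · have h1 : ∀ᶠ c in 𝓝[>] C, c ^ (1 / α) < a ∧ C < c :=
      ((hcont.eventually (gt_mem_nhds ha)).filter_mono nhdsWithin_le_nhds).and
        self_mem_nhdsWithin
    obtain ⟨c, hca, hcC⟩ := h1.exists
    filter_upwards [hupper c hcC] with γ hγ using hγ.trans_lt hca

/-- The mean excess over high levels of a variable with a Pareto tail: by the layer cake formula it
is the integral of the tail, which compares with that of a power. -/
theorem HasParetoTail.tendsto_integral_excess (hα : 1 < α) (hX : Measurable X)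
    (h : HasParetoTail P α X C) :
    (∀ v, 0 < v → Integrable (fun ω => max (X ω - v) 0) P) ∧
    Tendsto (fun v : ℝ => v ^ (α - 1) * ∫ ω, max (X ω - v) 0 ∂P) atTop (𝓝 (C / (α - 1))) := by
  have hα0 : 0 < α := by linarith
  have hα1 : 0 < α - 1 := by linarith
  obtain ⟨M, hM0, hM⟩ := h.exists_bound hα0
  have hset : ∀ v s : ℝ, 0 < s → {ω | s < max (X ω - v) 0} = {ω | s + v < X ω} := by
    intro v s hs
    ext ω
    simp only [Set.mem_ofPred_eq, lt_max_iff, hs.not_gt, or_false, lt_sub_iff_add_lt]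
  have hpow : ∀ v, 0 < v → IntegrableOn (fun s : ℝ => (s + v) ^ (-α)) (Set.Ioi 0) := fun v hv =>
    integrableOn_add_rpow_Ioi_of_lt (by linarith) (by linarith)
  have hdiv : ∀ t c : ℝ, 0 < t → t ^ α * P.real {ω | t < X ω} ≤ c →
      P.real {ω | t < X ω} ≤ c * t ^ (-α) := by
    intro t c ht hle
    rwa [Real.rpow_neg ht.le, ← div_eq_mul_inv, le_div_iff₀ (by positivity), mul_comm]
  have hdiv' : ∀ t c : ℝ, 0 < t → c ≤ t ^ α * P.real {ω | t < X ω} →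
      c * t ^ (-α) ≤ P.real {ω | t < X ω} := by
    intro t c ht hle
    rwa [Real.rpow_neg ht.le, ← div_eq_mul_inv, div_le_iff₀ (by positivity), mul_comm]
  have hmeas : ∀ v : ℝ, Measurable fun ω => max (X ω - v) 0 := fun v => by fun_prop
  have hint : ∀ v, 0 < v → Integrable (fun ω => max (X ω - v) 0) P := by
    intro v hv
    have h0 : 0 ≤ᵐ[P] fun ω => max (X ω - v) 0 := ae_of_all _ fun ω => le_max_right _ _
    refine ⟨(hmeas v).aestronglyMeasurable, (hasFiniteIntegral_iff_ofReal h0).2 ?_⟩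
    rw [lintegral_eq_lintegral_meas_lt P h0 (hmeas v).aemeasurable]
    have hfin := ((hpow v hv).const_mul M).lintegral_lt_top
    refine lt_of_le_of_lt (setLIntegral_mono' measurableSet_Ioi fun s hs => ?_) hfin
    replace hs : 0 < s := hs
    rw [hset v s hs, ← ofReal_measureReal]
    exact ENNReal.ofReal_le_ofReal (hdiv _ _ (by linarith) (hM _ (by linarith)))
  refine ⟨hint, ?_⟩
  have hlayer : ∀ v, 0 < v → ∫ ω, max (X ω - v) 0 ∂P =
      ∫ s in Set.Ioi (0 : ℝ), P.real {ω | s + v < X ω} := by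
    intro v hv
    rw [(hint v hv).integral_eq_integral_meas_lt (ae_of_all _ fun ω => le_max_right _ _)]
    exact setIntegral_congr_fun measurableSet_Ioi fun s hs => by simp only [hset v s hs]
  have htail : ∀ v, 0 < v →
      IntegrableOn (fun s : ℝ => P.real {ω | s + v < X ω}) (Set.Ioi 0) := by
    intro v hv
    have hanti : Antitone fun s : ℝ => P.real {ω | s + v < X ω} := fun s t hst =>
      measureReal_mono fun ω (hω : t + v < X ω) => (by linarith : s + v < X ω)
    refine ((hpow v hv).const_mul M).mono' hanti.measurable.aestronglyMeasurable ?_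
    refine (ae_restrict_iff' measurableSet_Ioi).2 (ae_of_all _ fun s hs => ?_)
    replace hs : 0 < s := hs
    rw [Real.norm_of_nonneg measureReal_nonneg]
    exact hdiv _ _ (by linarith) (hM _ (by linarith))
  have hconst : ∀ c v : ℝ, 0 < v →
      v ^ (α - 1) * ∫ s in Set.Ioi (0 : ℝ), c * (s + v) ^ (-α) = c / (α - 1) := by
    intro c v hv
    rw [integral_const_mul, integral_add_rpow_Ioi hα hv, mul_left_comm, ← mul_div_assoc,
      ← Real.rpow_add hv, show α - 1 + (1 - α) = 0 by ring, Real.rpow_zero, mul_one_div]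
  refine tendsto_order.2 ⟨fun a ha => ?_, fun a ha => ?_⟩
  · obtain ⟨a', ha1, ha2⟩ := exists_between ha
    rw [lt_div_iff₀ hα1] at ha2
    obtain ⟨T, hT⟩ := eventually_atTop.1 (h.eventually (lt_mem_nhds ha2))
    filter_upwards [eventually_ge_atTop T, eventually_gt_atTop 0] with v hvT hv
    refine ha1.trans_le ?_
    rw [← mul_div_cancel_right₀ a' hα1.ne', ← hconst _ v hv, hlayer v hv]
    refine mul_le_mul_of_nonneg_left (setIntegral_mono_on ((hpow v hv).const_mul _) (htail v hv)
      measurableSet_Ioi fun s hs => ?_) (by positivity)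
    replace hs : 0 < s := hs
    exact hdiv' _ _ (by linarith) (hT _ (by linarith)).le
  · obtain ⟨a', ha1, ha2⟩ := exists_between ha
    rw [div_lt_iff₀ hα1] at ha1
    obtain ⟨T, hT⟩ := eventually_atTop.1 (h.eventually (gt_mem_nhds ha1))
    filter_upwards [eventually_ge_atTop T, eventually_gt_atTop 0] with v hvT hv
    refine lt_of_le_of_lt ?_ ha2
    rw [← mul_div_cancel_right₀ a' hα1.ne', ← hconst _ v hv, hlayer v hv]
    refine mul_le_mul_of_nonneg_left (setIntegral_mono_on (htail v hv) ((hpow v hv).const_mul _)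
      measurableSet_Ioi fun s hs => ?_) (by positivity)
    replace hs : 0 < s := hs
    exact hdiv _ _ (by linarith) (hT _ (by linarith)).le

/-- Karamata's theorem for Pareto tails: the conditional mean above a level `v` is asymptotically
`α / (α - 1) * v`. -/
theorem HasParetoTail.tendsto_integral_cond (hα : 1 < α) (hX : Measurable X) (hC : 0 < C)
    (h : HasParetoTail P α X C) :
    Tendsto (fun v : ℝ => (∫ ω, X ω ∂(P[|{ω | v < X ω}])) / v) atTop (𝓝 (α / (α - 1))) := by
  have hα1 : 0 < α - 1 := by linarith
  obtain ⟨hint, hlim⟩ := h.tendsto_integral_excess hα hX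
  have hlim2 := (hlim.div h hC.ne').const_add 1
  have hval : 1 + C / (α - 1) / C = α / (α - 1) := by
    field_simp
    ring
  rw [hval] at hlim2
  refine hlim2.congr' ?_
  filter_upwards [eventually_gt_atTop 0, h.eventually (lt_mem_nhds hC)] with v hv hpos
  have hp : 0 < P.real {ω | v < X ω} := pos_of_mul_pos_right hpos (by positivity)
  have hms : MeasurableSet {ω | v < X ω} := measurableSet_lt measurable_const hX
  have hexc : ∫ ω in {ω | v < X ω}, X ω ∂P =
      ∫ ω, max (X ω - v) 0 ∂P + v * P.real {ω | v < X ω} := by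
    have h1 : ∫ ω in {ω | v < X ω}, X ω ∂P =
        ∫ ω in {ω | v < X ω}, (max (X ω - v) 0 + v) ∂P := by
      refine setIntegral_congr_fun hms fun ω hω => ?_
      replace hω : v < X ω := hω
      rw [max_eq_left (by linarith), sub_add_cancel]
    rw [h1, integral_add (hint v hv).integrableOn (integrable_const v),
      setIntegral_eq_integral_of_forall_compl_eq_zero]
    · simp [mul_comm]
    · intro ω hω
      replace hω : ¬ v < X ω := hω
      exact max_eq_right (by linarith)
  rw [ProbabilityTheory.cond, integral_smul_measure, hexc, ENNReal.toReal_inv, ← measureReal_def,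
    smul_eq_mul, Pi.div_apply, Real.rpow_sub hv, Real.rpow_one]
  have : 0 < v ^ α := by positivity
  field_simp
  ring

theorem HasParetoTail.tailRiskAsymptotics (hα : 1 < α) (hX : Measurable X) (hC : 0 < C)
    (h : HasParetoTail P α X C) : TailRiskAsymptotics P α X C := by
  have hα0 : 0 < α := by linarith
  have hα1 : 0 < α - 1 := by linarith
  have hVaR := h.tendsto_VaR hα0 hC
  have hroot : 0 < C ^ (1 / α) := Real.rpow_pos_of_pos hC _
  have hr : 0 < α / (α - 1) := by positivity
  refine ⟨?_, ?_⟩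
  · have h1 := ((h.tendsto_integral_cond hα hX hC).comp
      (tendsto_VaR_atTop hα0 hC hVaR)).div_const (α / (α - 1))
    rw [div_self hr.ne'] at h1
    refine h1.congr fun γ => ?_
    simp only [Function.comp_apply, CoTE]
    rw [div_div, mul_comm (VaR P X γ)]
  · have h1 := hVaR.div_const (C ^ (1 / α))
    rw [div_self hroot.ne'] at h1
    refine h1.congr' ?_
    filter_upwards [self_mem_nhdsWithin] with γ hγ
    replace hγ : 0 < γ := hγ
    rw [Real.rpow_neg hγ.le]
    have : 0 < γ ^ (1 / α) := by positivity
    field_simp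

end RiskMeasures

/-! ### Asymptotic independence and dependence from the exponent measure -/

section RegularVariation

variable {Ω : Type*} [MeasurableSpace Ω] {P : Measure Ω} {d : ℕ} {V : Ω → Fin d → ℝ}

/-- A function on `[0,∞]^d` that vanishes near the origin has compact support on the punctured
orthant, because `[0,∞]^d` is compact. -/
theorem hasCompactSupport_of_eq_zero_near {f : (Fin d → ℝ≥0∞) → ℝ} {δ : ℝ≥0∞} (hδ : 0 < δ)
    (hf : ∀ x, (∀ j, x j ≤ δ) → f x = 0) :
    HasCompactSupport (fun x : PuncturedOrthant d => f x.1) := by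
  have hclosed : IsClosed {x : Fin d → ℝ≥0∞ | ∃ j, δ ≤ x j} := by
    simp only [Set.ofPred_exists]
    exact isClosed_iUnion_of_finite fun j => isClosed_le continuous_const (continuous_apply j)
  refine HasCompactSupport.intro
    (K := (Subtype.val : PuncturedOrthant d → _) ⁻¹' {x | ∃ j, δ ≤ x j}) ?_ ?_
  · rw [Subtype.isCompact_iff]
    have himage : (Subtype.val : PuncturedOrthant d → _) ''
        (Subtype.val ⁻¹' {x : Fin d → ℝ≥0∞ | ∃ j, δ ≤ x j}) = {x | ∃ j, δ ≤ x j} := by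
      rw [Set.image_preimage_eq_iff]
      rintro x ⟨j, hj⟩
      refine ⟨⟨x, fun h0 => ?_⟩, rfl⟩
      rw [Set.mem_singleton_iff.1 h0] at hj
      exact absurd hj (not_le.2 hδ)
    erw [himage]
    exact hclosed.isCompact
  · intro x hx
    simp only [Set.mem_preimage, Set.mem_ofPred_eq, not_exists, not_le] at hx
    exact hf _ fun j => (hx j).le

theorem integral_scaledLaw [IsFiniteMeasure P] (hV : Measurable V) (b : ℕ → ℝ) (n : ℕ)
    {f : (Fin d → ℝ≥0∞) → ℝ} (hf : Continuous f) (h0 : f 0 = 0) :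
    ∫ x, f x.1 ∂(scaledLaw P V b n) =
      n * ∫ ω, f (fun j => ENNReal.ofReal (V ω j / b n)) ∂P := by
  have hm : Measurable fun ω (j : Fin d) => ENNReal.ofReal (V ω j / b n) := by fun_prop
  rw [scaledLaw, integral_smul_measure,
    integral_subtype_comap (measurableSet_singleton (0 : Fin d → ℝ≥0∞)).compl,
    setIntegral_eq_integral_of_forall_compl_eq_zero, integral_map hm.aemeasurable]
  · simp
  · exact hf.measurable.aestronglyMeasurable
  · intro x hx
    simp only [Set.mem_compl_iff, Set.mem_singleton_iff, not_not] at hx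
    rw [hx, h0]

/-- If a continuous function vanishes near the origin and almost everywhere for the exponent
measure, then its value at the rescaled vector is at least `1` with probability `o (1 / n)` only:
this is vague convergence followed by Markov's inequality. -/
theorem IsExponentMeasure.tendsto_zero [IsFiniteMeasure P] {b : ℕ → ℝ}
    {ν : Measure (PuncturedOrthant d)} (hν : IsExponentMeasure P V b ν) (hV : Measurable V)
    {f : (Fin d → ℝ≥0∞) → ℝ} (hf : Continuous f) (hf0 : ∀ x, 0 ≤ f x) {δ : ℝ≥0∞} (hδ : 0 < δ)
    (hnear : ∀ x, (∀ j, x j ≤ δ) → f x = 0) (hae : ∀ᵐ x ∂ν, f x.1 = 0) :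
    Tendsto (fun n : ℕ => (n : ℝ) *
      P.real {ω | 1 ≤ f (fun j => ENNReal.ofReal (V ω j / b n))}) atTop (𝓝 0) := by
  have hlim := hν.vague (fun x => f x.1) (hf.comp continuous_subtype_val)
    (hasCompactSupport_of_eq_zero_near hδ hnear)
  rw [integral_eq_zero_of_ae hae] at hlim
  refine squeeze_zero (fun n => by positivity) (fun n => ?_) hlim
  rw [integral_scaledLaw hV b n hf (hnear 0 fun j => zero_le)]
  gcongr
  have hm : Measurable fun ω (j : Fin d) => ENNReal.ofReal (V ω j / b n) := by fun_prop
  obtain ⟨C, hC⟩ := (isCompact_range hf).isBounded.exists_norm_le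
  have hint : Integrable (fun ω => f (fun j => ENNReal.ofReal (V ω j / b n))) P :=
    Integrable.of_bound (hf.measurable.comp hm).aestronglyMeasurable C
      (ae_of_all _ fun ω => hC _ ⟨_, rfl⟩)
  simpa using mul_meas_ge_le_integral_of_nonneg (ae_of_all _ fun ω => hf0 _) hint 1

variable {α : ℝ} {ν : Measure (PuncturedOrthant d)}

/-- Under asymptotic independence no two claims are large simultaneously. -/
theorem ConcentratedOnAxes.min_tail [IsFiniteMeasure P] (hα : 0 < α)
    (hax : ConcentratedOnAxes ν) (hν : IsExponentMeasure P V (fun n : ℕ => (n : ℝ) ^ (1 / α)) ν)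
    (hV : Measurable V) {j k : Fin d} (hjk : j ≠ k) :
    HasParetoTail P α (fun ω => min (V ω j) (V ω k)) 0 := by
  -- A continuous function, zero unless both coordinates exceed `1/2`, hence zero on the axes, and
  -- equal to `1` as soon as both are at least `1`.
  set f : (Fin d → ℝ≥0∞) → ℝ := fun x =>
    max 0 (2 * (min (min (x j) (x k)) 1).toReal - 1) with hfdef
  have hf : Continuous f := by
    have h1 : Continuous fun x : Fin d → ℝ≥0∞ => (min (min (x j) (x k)) 1).toReal :=
      ENNReal.continuousOn_toReal.comp_continuous (by fun_prop) fun x =>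
        ne_top_of_le_ne_top ENNReal.one_ne_top (min_le_right _ _)
    fun_prop
  have hfz : ∀ x : Fin d → ℝ≥0∞, x j ≤ 2⁻¹ ∨ x k ≤ 2⁻¹ → f x = 0 := by
    intro x hx
    have h1 : min (min (x j) (x k)) 1 ≤ 2⁻¹ := by
      rcases hx with hx | hx
      · exact ((min_le_left _ _).trans (min_le_left _ _)).trans hx
      · exact ((min_le_left _ _).trans (min_le_right _ _)).trans hx
    have h2 : (min (min (x j) (x k)) 1).toReal ≤ 2⁻¹ := by
      simpa using ENNReal.toReal_mono (by simp) h1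
    refine max_eq_left ?_
    linarith
  have hae : ∀ᵐ x ∂ν, f x.1 = 0 := by
    have hax' : ∀ᵐ x ∂ν, x ∈ {x : PuncturedOrthant d | ∃ j, ∀ k, k ≠ j → x.1 k = 0} :=
      mem_ae_iff.2 hax
    filter_upwards [hax'] with x hx
    obtain ⟨i, hi⟩ := hx
    refine hfz _ ?_
    by_cases hji : j = i
    · right
      rw [hi k (hji ▸ hjk.symm)]
      exact zero_le
    · left
      rw [hi j hji]
      exact zero_le
  refine hasParetoTail_zero_of_seq hα ?_
  refine squeeze_zero' (.of_forall fun n => by positivity) ?_ (hν.tendsto_zero hV hf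
    (fun x => le_max_left _ _) (δ := 2⁻¹) (by simp) (fun x hx => hfz x (Or.inl (hx j))) hae)
  filter_upwards [eventually_gt_atTop 0] with n hn
  gcongr ?_ * ?_
  refine measureReal_mono fun ω hω => ?_
  have hb : (0 : ℝ) < (n : ℝ) ^ (1 / α) := by positivity
  obtain ⟨h1, h2⟩ := lt_min_iff.1 (show (n : ℝ) ^ (1 / α) < min (V ω j) (V ω k) from hω)
  have hone : ∀ l, (n : ℝ) ^ (1 / α) < V ω l → 1 ≤ ENNReal.ofReal (V ω l / (n : ℝ) ^ (1 / α)) := by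
    intro l hl
    rw [ENNReal.one_le_ofReal, one_le_div hb]
    exact hl.le
  have hmin : min (min (ENNReal.ofReal (V ω j / (n : ℝ) ^ (1 / α)))
      (ENNReal.ofReal (V ω k / (n : ℝ) ^ (1 / α)))) 1 = 1 :=
    min_eq_right (le_min (hone j h1) (hone k h2))
  simp only [Set.mem_ofPred_eq, hfdef, hmin]
  norm_num

/-- Under asymptotic full dependence the claims, each divided by the constant that standardizes its
tail, differ negligibly. The difference of coordinates is not continuous at infinity, so it is
truncated at level `M`, and `M → ∞` at the end. -/
theorem ConcentratedOnRay.abs_sub_tail [IsFiniteMeasure P] (hα : 0 < α) {K : Fin d → ℝ}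
    (hK : ∀ j, 0 < K j) (hray : ConcentratedOnRay α K ν)
    (hν : IsExponentMeasure P V (fun n : ℕ => (n : ℝ) ^ (1 / α)) ν)
    (hV : Measurable V) (hV0 : ∀ ω j, 0 ≤ V ω j)
    (htail : ∀ j, HasParetoTail P α (fun ω => V ω j) (K j)) (i j : Fin d) :
    HasParetoTail P α
      (fun ω => |V ω i / K i ^ (1 / α) - V ω j / K j ^ (1 / α)|) 0 := by
  set k : Fin d → ℝ := fun l => K l ^ (1 / α) with hkdef
  have hk : ∀ l, 0 < k l := fun l => Real.rpow_pos_of_pos (hK l) _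
  have hkα : ∀ l, k l ^ α = K l := fun l => by
    rw [hkdef]
    simp only
    rw [← Real.rpow_mul (hK l).le, one_div_mul_cancel hα.ne', Real.rpow_one]
  refine hasParetoTail_zero_of_seq hα ?_
  have hstd : ∀ l, HasParetoTail P α (fun ω => V ω l / k l) 1 := by
    intro l
    have h := (htail l).const_mul hα (inv_nonneg.2 (hk l).le)
    rw [Real.inv_rpow (hk l).le, hkα, inv_mul_cancel₀ (hK l).ne'] at h
    simpa only [div_eq_inv_mul] using h
  -- the claim for the standardized coordinates truncated at `M`
  have key : ∀ M : ℝ, 1 ≤ M → Tendsto (fun n : ℕ => (n : ℝ) * P.real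
      {ω | (n : ℝ) ^ (1 / α) < |min (V ω i / k i) (M * (n : ℝ) ^ (1 / α)) -
        min (V ω j / k j) (M * (n : ℝ) ^ (1 / α))|}) atTop (𝓝 0) := by
    intro M hM
    have hM0 : 0 ≤ M := by linarith
    set u : Fin d → (Fin d → ℝ≥0∞) → ℝ := fun l x =>
      (min (x l) (ENNReal.ofReal (M * k l))).toReal / k l with hu
    have hucont : ∀ l, Continuous (u l) := fun l => by
      have h1 : Continuous fun x : Fin d → ℝ≥0∞ =>
          (min (x l) (ENNReal.ofReal (M * k l))).toReal :=
        ENNReal.continuousOn_toReal.comp_continuous (by fun_prop) fun x =>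
          ne_top_of_le_ne_top ENNReal.ofReal_ne_top (min_le_right _ _)
      exact h1.div_const _
    have hu0 : ∀ l x, 0 ≤ u l x := fun l x => div_nonneg ENNReal.toReal_nonneg (hk l).le
    have hureal : ∀ l (x : Fin d → ℝ≥0∞) (y : ℝ), 0 ≤ y → x l = ENNReal.ofReal (y * k l) →
        u l x = min y M := by
      intro l x y hy hx
      simp only [hu]
      rw [hx, ← ENNReal.ofReal_min,
        ENNReal.toReal_ofReal (le_min (mul_nonneg hy (hk l).le) (mul_nonneg hM0 (hk l).le)),
        ← min_mul_of_nonneg _ _ (hk l).le, mul_div_cancel_right₀ _ (hk l).ne']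
    -- Zero on the ray and near the origin, and at least `1` when `u i` and `u j` differ by at least
    -- `1`.
    set f : (Fin d → ℝ≥0∞) → ℝ := fun x => max 0 (2 * |u i x - u j x| - 1) with hfdef
    have hf : Continuous f := by
      have := hucont i
      have := hucont j
      fun_prop
    have hnear : ∀ x : Fin d → ℝ≥0∞, (∀ l, x l ≤ ENNReal.ofReal (2⁻¹ * min (k i) (k j))) →
        f x = 0 := by
      intro x hx
      have hsmall : ∀ l, min (k i) (k j) ≤ k l → u l x ≤ 2⁻¹ := by
        intro l hl
        have hpos : 0 < min (k i) (k j) := lt_min (hk i) (hk j)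
        have h1 : (min (x l) (ENNReal.ofReal (M * k l))).toReal ≤ 2⁻¹ * min (k i) (k j) := by
          refine ENNReal.toReal_le_of_le_ofReal (by positivity) ((min_le_left _ _).trans (hx l))
        rw [hu]
        simp only
        rw [div_le_iff₀ (hk l)]
        linarith
      have h1 := hsmall i (min_le_left _ _)
      have h2 := hsmall j (min_le_right _ _)
      have h3 : |u i x - u j x| ≤ 2⁻¹ :=
        abs_sub_le_iff.2 ⟨by linarith [hu0 j x], by linarith [hu0 i x]⟩
      refine max_eq_left ?_
      linarith
    have hae : ∀ᵐ x ∂ν, f x.1 = 0 := by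
      have hray' : ∀ᵐ x ∂ν, x ∈ {x : PuncturedOrthant d |
          ∃ s : ℝ, 0 < s ∧ ∀ j, x.1 j = ENNReal.ofReal (s * K j ^ (1 / α))} :=
        mem_ae_iff.2 hray
      filter_upwards [hray'] with x hx
      obtain ⟨s, hs, hx⟩ := hx
      have h1 := hureal i x.1 s hs.le (hx i)
      have h2 := hureal j x.1 s hs.le (hx j)
      simp [hfdef, h1, h2]
    refine squeeze_zero' (.of_forall fun n => by positivity) ?_ (hν.tendsto_zero hV hf
      (fun x => le_max_left _ _) (by simp [hk]) hnear hae)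
    filter_upwards [eventually_gt_atTop 0] with n hn
    gcongr ?_ * ?_
    refine measureReal_mono fun ω hω => ?_
    have hb : (0 : ℝ) < (n : ℝ) ^ (1 / α) := by positivity
    have hval : ∀ l, u l (fun j => ENNReal.ofReal (V ω j / (n : ℝ) ^ (1 / α))) =
        min (V ω l / k l) (M * (n : ℝ) ^ (1 / α)) / (n : ℝ) ^ (1 / α) := by
      intro l
      have hkl := (hk l).ne'
      rw [hureal l (fun j => ENNReal.ofReal (V ω j / (n : ℝ) ^ (1 / α)))
        (V ω l / k l / (n : ℝ) ^ (1 / α)) (div_nonneg (div_nonneg (hV0 ω l) (hk l).le) hb.le)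
        (by congr 1; field_simp), ← min_div_div_right hb.le, mul_div_cancel_right₀ _ hb.ne']
    have hω' : (n : ℝ) ^ (1 / α) < |min (V ω i / k i) (M * (n : ℝ) ^ (1 / α)) -
        min (V ω j / k j) (M * (n : ℝ) ^ (1 / α))| := hω
    simp only [Set.mem_ofPred_eq, hfdef, hval]
    rw [← sub_div, abs_div, abs_of_pos hb]
    have := (one_lt_div hb).2 hω'
    exact le_max_of_le_right (by linarith)
  have hseq : Tendsto (fun n : ℕ => (n : ℝ) ^ (1 / α)) atTop atTop :=
    (tendsto_rpow_atTop (one_div_pos.2 hα)).comp tendsto_natCast_atTop_atTop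
  have hbig : ∀ M : ℝ, 1 ≤ M → ∀ l, Tendsto (fun n : ℕ => (n : ℝ) *
      P.real {ω | M * (n : ℝ) ^ (1 / α) < V ω l / k l}) atTop (𝓝 (M⁻¹ ^ α)) := by
    intro M hM l
    have hM0 : 0 < M := by linarith
    have h := ((hstd l).const_mul hα (inv_nonneg.2 hM0.le)).comp hseq
    rw [mul_one] at h
    refine h.congr fun n => ?_
    simp only [Function.comp_apply]
    rw [← Real.rpow_mul n.cast_nonneg, one_div_mul_cancel hα.ne', Real.rpow_one]
    congr 2
    ext ω
    simp only [Set.mem_ofPred_eq]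
    rw [← div_eq_inv_mul, lt_div_iff₀ hM0, mul_comm]
  refine tendsto_order.2 ⟨fun a ha => .of_forall fun n => ha.trans_le (by positivity),
    fun a ha => ?_⟩
  have hM : ∃ M : ℝ, 1 ≤ M ∧ M⁻¹ ^ α + M⁻¹ ^ α < a := by
    have h1 : Tendsto (fun M : ℝ => M⁻¹ ^ α + M⁻¹ ^ α) atTop (𝓝 0) := by
      have h2 : Tendsto (fun M : ℝ => M⁻¹ ^ α) atTop (𝓝 0) := by
        have := tendsto_inv_atTop_zero (𝕜 := ℝ) |>.rpow_const (p := α) (Or.inr hα.le)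
        rwa [Real.zero_rpow hα.ne'] at this
      simpa using h2.add h2
    exact ((eventually_ge_atTop 1).and (h1.eventually (gt_mem_nhds ha))).exists
  obtain ⟨M, hM1, hMa⟩ := hM
  have hlim := (key M hM1).add ((hbig M hM1 i).add (hbig M hM1 j))
  rw [_root_.zero_add] at hlim
  filter_upwards [hlim.eventually (gt_mem_nhds hMa)] with n hn
  refine lt_of_le_of_lt ?_ hn
  rw [← mul_add, ← mul_add]
  gcongr
  refine (measureReal_mono ?_).trans ((measureReal_union_le _ _).trans
    (add_le_add_right (measureReal_union_le _ _) _))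
  intro ω hω
  simp only [Set.mem_ofPred_eq, Set.mem_union] at *
  by_contra! hcon
  obtain ⟨h1, h2, h3⟩ := hcon
  rw [min_eq_left h2, min_eq_left h3] at h1
  exact absurd hω (not_lt.2 h1)

end RegularVariation

/-! ### Seminorms on `ℝⁿ` -/

section Seminorms

variable {n : ℕ}

theorem seminorm_le_sum (ψ : Seminorm ℝ (Fin n → ℝ)) (v : Fin n → ℝ) :
    ψ v ≤ ∑ j, |v j| * ψ (Pi.single j 1) := by
  have h1 : v = ∑ j, v j • (Pi.single j 1 : Fin n → ℝ) := by
    simpa using (pi_eq_sum_univ' v)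
  calc ψ v = ψ (∑ j, v j • (Pi.single j 1 : Fin n → ℝ)) := by rw [← h1]
    _ ≤ ∑ j, ψ (v j • (Pi.single j 1 : Fin n → ℝ)) :=
        Finset.le_sum_of_subadditive ψ (map_zero ψ).le (map_add_le_add ψ) _ _
    _ = _ := by simp [map_smul_eq_mul]

theorem seminorm_le_mul_norm (ψ : Seminorm ℝ (Fin n → ℝ)) (v : Fin n → ℝ) :
    ψ v ≤ (∑ j, ψ (Pi.single j 1)) * ‖v‖ := by
  rw [Finset.sum_mul]
  refine (seminorm_le_sum ψ v).trans (Finset.sum_le_sum fun j _ => ?_)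
  rw [mul_comm]
  gcongr
  exact norm_le_pi_norm v j

theorem continuous_seminorm (ψ : Seminorm ℝ (Fin n → ℝ)) : Continuous ψ := by
  refine (LipschitzWith.of_dist_le_mul (K := (∑ j, ψ (Pi.single j 1)).toNNReal)
    fun x y => ?_).continuous
  rw [Real.dist_eq, dist_eq_norm,
    Real.coe_toNNReal _ (Finset.sum_nonneg fun j _ => apply_nonneg ψ _)]
  exact (abs_sub_map_le_sub ψ x y).trans (seminorm_le_mul_norm ψ _)

/-- If one coordinate of a nonnegative vector dominates the others, then any seminorm is close to
its `ℓ¹`-type upper bound. -/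
theorem abs_seminorm_sub_sum_le (ψ : Seminorm ℝ (Fin n → ℝ)) {v : Fin n → ℝ} (hv : ∀ j, 0 ≤ v j) :
    |ψ v - ∑ j, ψ (Pi.single j 1) * v j| ≤
      ∑ k, ∑ j ∈ Finset.univ.erase k, 2 * ψ (Pi.single k 1) * min (v k) (v j) := by
  rcases isEmpty_or_nonempty (Fin n) with hn | hn
  · simp [Subsingleton.elim v 0]
  obtain ⟨m, hm⟩ := Finite.exists_max v
  have hψ : ∀ j, 0 ≤ ψ (Pi.single j 1) := fun j => apply_nonneg ψ _
  set S : ℝ := ∑ k ∈ Finset.univ.erase m, ψ (Pi.single k 1) * v k with hS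
  have hsum : ∑ j, ψ (Pi.single j 1) * v j = ψ (Pi.single m 1) * v m + S :=
    (Finset.add_sum_erase _ _ (Finset.mem_univ m)).symm
  have hrest : ψ (v - v m • Pi.single m 1) ≤ S := by
    refine (seminorm_le_sum ψ _).trans_eq ?_
    rw [← Finset.add_sum_erase _ _ (Finset.mem_univ m), hS]
    simp only [Pi.sub_apply, Pi.smul_apply, Pi.single_eq_same, smul_eq_mul, mul_one, sub_self,
      abs_zero, zero_mul, zero_add]
    refine Finset.sum_congr rfl fun k hk => ?_
    rw [Pi.single_eq_of_ne (Finset.ne_of_mem_erase hk), mul_zero, sub_zero, abs_of_nonneg (hv k),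
      mul_comm]
  have hmain : |ψ v - ψ (Pi.single m 1) * v m| ≤ S := by
    refine le_trans ?_ ((abs_sub_map_le_sub ψ _ _).trans hrest)
    rw [map_smul_eq_mul, Real.norm_of_nonneg (hv m), mul_comm (v m)]
  have hSle : 2 * S ≤ ∑ k, ∑ j ∈ Finset.univ.erase k, 2 * ψ (Pi.single k 1) * min (v k) (v j) := by
    have hnn : ∀ k j, 0 ≤ 2 * ψ (Pi.single k 1) * min (v k) (v j) := fun k j =>
      mul_nonneg (mul_nonneg zero_le_two (hψ k)) (le_min (hv k) (hv j))
    rw [hS, Finset.mul_sum]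
    refine (Finset.sum_le_sum fun k hk => ?_).trans (Finset.sum_le_sum_of_subset_of_nonneg
      (Finset.erase_subset m Finset.univ) fun k _ _ => Finset.sum_nonneg fun j _ => hnn k j)
    have hmk : m ∈ Finset.univ.erase k :=
      Finset.mem_erase.2 ⟨(Finset.ne_of_mem_erase hk).symm, Finset.mem_univ m⟩
    refine le_trans (le_of_eq ?_) (Finset.single_le_sum (fun j _ => hnn k j) hmk)
    rw [min_eq_left (hm k), mul_assoc]
  rw [hsum]
  rw [abs_le] at hmain
  refine (abs_le.2 ⟨?_, ?_⟩).trans hSle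
  · linarith [hmain.1]
  · linarith [hmain.2, hmain.1]

end Seminorms

/-! ### Tails of seminorms of the claims -/

section Claims

variable {Ω : Type*} [MeasurableSpace Ω] {P : Measure Ω} [IsFiniteMeasure P] {d : ℕ}
  {V : Ω → Fin d → ℝ} {α : ℝ} {ν : Measure (PuncturedOrthant d)} {K : Fin d → ℝ}

/-- Under asymptotic independence `ψ V` behaves like `∑ j, ψ (e j) * V j`, to which the principle of
a single big jump applies. -/
theorem ConcentratedOnAxes.seminorm_tail (hα : 0 < α) (hax : ConcentratedOnAxes ν)
    (hν : IsExponentMeasure P V (fun n : ℕ => (n : ℝ) ^ (1 / α)) ν)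
    (hV : Measurable V) (hV0 : ∀ ω j, 0 ≤ V ω j)
    (htail : ∀ j, HasParetoTail P α (fun ω => V ω j) (K j)) (ψ : Seminorm ℝ (Fin d → ℝ)) :
    HasParetoTail P α (fun ω => ψ (V ω)) (∑ j, ψ (Pi.single j 1) ^ α * K j) := by
  have hψ : ∀ j, 0 ≤ ψ (Pi.single j 1) := fun j => apply_nonneg ψ _
  have hsum : HasParetoTail P α (fun ω => ∑ j, ψ (Pi.single j 1) * V ω j)
      (∑ j, ψ (Pi.single j 1) ^ α * K j) := by
    refine HasParetoTail.sum_of_min hα Finset.univ (fun j => by fun_prop)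
      (fun j ω => mul_nonneg (hψ j) (hV0 ω j)) (fun j => (htail j).const_mul hα (hψ j))
      fun i j hij => ?_
    have hneg := (hax.min_tail hα hν hV hij).const_mul hα (add_nonneg (hψ i) (hψ j))
    rw [mul_zero] at hneg
    refine hneg.mono_zero fun ω => ?_
    rcases le_total (V ω i) (V ω j) with hle | hle
    · rw [min_eq_left hle]
      refine (min_le_left _ _).trans (mul_le_mul_of_nonneg_right ?_ (hV0 ω i))
      linarith [hψ j]
    · rw [min_eq_right hle]
      refine (min_le_right _ _).trans (mul_le_mul_of_nonneg_right ?_ (hV0 ω j))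
      linarith [hψ i]
  refine hsum.of_abs_sub_le hα (R := fun ω => ∑ k, ∑ j ∈ Finset.univ.erase k,
    2 * ψ (Pi.single k 1) * min (V ω k) (V ω j)) ?_ fun ω => abs_seminorm_sub_sum_le ψ (hV0 ω)
  refine HasParetoTail.sum_zero hα _ fun k _ => HasParetoTail.sum_zero hα _ fun j hj => ?_
  have hneg := (hax.min_tail hα hν hV (Finset.ne_of_mem_erase hj).symm).const_mul hα
    (mul_nonneg zero_le_two (hψ k))
  rwa [mul_zero] at hneg

/-- Under asymptotic full dependence `V` is, up to a negligible error, a random multiple of the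
vector `k = (K j ^ (1 / α))`, the multiple being `V i / k i` for any fixed `i`. -/
theorem ConcentratedOnRay.seminorm_tail (hα : 0 < α) (hK : ∀ j, 0 < K j)
    (hray : ConcentratedOnRay α K ν)
    (hν : IsExponentMeasure P V (fun n : ℕ => (n : ℝ) ^ (1 / α)) ν)
    (hV : Measurable V) (hV0 : ∀ ω j, 0 ≤ V ω j)
    (htail : ∀ j, HasParetoTail P α (fun ω => V ω j) (K j)) (ψ : Seminorm ℝ (Fin d → ℝ)) :
    HasParetoTail P α (fun ω => ψ (V ω)) (ψ (fun j => K j ^ (1 / α)) ^ α) := by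
  rcases isEmpty_or_nonempty (Fin d) with hd | ⟨⟨i⟩⟩
  · have h0 : ∀ v : Fin d → ℝ, ψ v = 0 := fun v => by
      rw [Subsingleton.elim v 0, map_zero]
    simp only [h0, Real.zero_rpow hα.ne']
    exact hasParetoTail_zero
  set k : Fin d → ℝ := fun j => K j ^ (1 / α) with hkdef
  have hk : ∀ j, 0 < k j := fun j => Real.rpow_pos_of_pos (hK j) _
  have hkα : k i ^ α = K i := by
    rw [hkdef]
    simp only
    rw [← Real.rpow_mul (hK i).le, one_div_mul_cancel hα.ne', Real.rpow_one]
  have hψk : 0 ≤ ψ k := apply_nonneg ψ k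
  have hmain : HasParetoTail P α (fun ω => ψ k / k i * V ω i) (ψ k ^ α) := by
    have h1 := (htail i).const_mul hα (div_nonneg hψk (hk i).le)
    rwa [Real.div_rpow hψk (hk i).le, hkα, div_mul_cancel₀ _ (hK i).ne'] at h1
  refine hmain.of_abs_sub_le hα
    (R := fun ω => ∑ j, k j * ψ (Pi.single j 1) * |V ω j / k j - V ω i / k i|) ?_ fun ω => ?_
  · refine HasParetoTail.sum_zero hα _ fun j _ => ?_
    have hneg := (hray.abs_sub_tail hα hK hν hV hV0 htail j i).const_mul hα
      (mul_nonneg (hk j).le (apply_nonneg ψ (Pi.single j 1)))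
    rwa [mul_zero] at hneg
  · have h1 : ψ k / k i * V ω i = ψ ((V ω i / k i) • k) := by
      rw [map_smul_eq_mul, Real.norm_of_nonneg (div_nonneg (hV0 ω i) (hk i).le)]
      ring
    rw [h1]
    refine (abs_sub_map_le_sub ψ _ _).trans ((seminorm_le_sum ψ _).trans_eq ?_)
    refine Finset.sum_congr rfl fun j _ => ?_
    have h2 : (V ω - (V ω i / k i) • k) j = k j * (V ω j / k j - V ω i / k i) := by
      rw [mul_sub, mul_div_cancel₀ _ (hk j).ne', Pi.sub_apply, Pi.smul_apply, smul_eq_mul]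
      ring
    rw [h2, abs_mul, abs_of_pos (hk j)]
    ring

end Claims

/-! ### Random matrices independent of the claims -/

section RandomMatrix

variable {Ω : Type*} [MeasurableSpace Ω] {P : Measure Ω} {q d : ℕ} {V : Ω → Fin d → ℝ} {α : ℝ}
  {A : Ω → Matrix (Fin q) (Fin d) ℝ}

theorem measurable_seminorm_mulVec (N : Seminorm ℝ (Fin q → ℝ)) :
    Measurable fun p : (Fin q → Fin d → ℝ) × (Fin d → ℝ) => N ((Matrix.of p.1).mulVec p.2) := by
  refine ((continuous_seminorm N).comp ?_).measurable
  refine continuous_pi fun i => ?_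
  simp only [Matrix.mulVec, dotProduct, Matrix.of_apply]
  fun_prop

theorem memLp_seminorm_mulVec {p : ℝ≥0∞} (hA : Measurable fun ω i j => A ω i j)
    (hAp : ∀ i j, MemLp (fun ω => A ω i j) p P) (N : Seminorm ℝ (Fin q → ℝ)) (v : Fin d → ℝ) :
    MemLp (fun ω => N ((A ω).mulVec v)) p P := by
  have hrow : ∀ i, MemLp (fun ω => (A ω).mulVec v i) p P := fun i =>
    memLp_finsetSum Finset.univ (f := fun j ω => A ω i j * v j) fun j _ =>
      (hAp i j).mul_const (v j)
  have hbound : MemLp (fun ω => ∑ i, |(A ω).mulVec v i| * N (Pi.single i 1)) p P :=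
    memLp_finsetSum Finset.univ (f := fun i ω => |(A ω).mulVec v i| * N (Pi.single i 1))
      fun i _ => (hrow i).norm.mul_const (N (Pi.single i 1))
  refine hbound.mono' ?_ (ae_of_all _ fun ω => ?_)
  · exact ((measurable_seminorm_mulVec N).comp
      (hA.prodMk measurable_const)).aestronglyMeasurable
  · rw [Real.norm_of_nonneg (apply_nonneg N _)]
    exact seminorm_le_sum N _

theorem integrable_rpow_of_memLp (hα : 0 < α) {f : Ω → ℝ} (hf : MemLp f (ENNReal.ofReal α) P)
    (hf0 : ∀ ω, 0 ≤ f ω) : Integrable (fun ω => f ω ^ α) P := by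
  have h := hf.integrable_norm_rpow (by simpa using hα) ENNReal.ofReal_ne_top
  rw [ENNReal.toReal_ofReal hα.le] at h
  exact h.congr (ae_of_all _ fun ω => by simp only [Real.norm_of_nonneg (hf0 ω)])

theorem tail_le_of_le_mul [IsFiniteMeasure P] {X Y : Ω → ℝ} {B M : ℝ} (hB : 0 ≤ B)
    (hM0 : 0 ≤ M) (hM : ∀ t : ℝ, 0 < t → t ^ α * P.real {ω | t < Y ω} ≤ M)
    (hXY : ∀ ω, X ω ≤ B * Y ω) {t : ℝ} (ht : 0 < t) :
    t ^ α * P.real {ω | t < X ω} ≤ B ^ α * M := by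
  rcases hB.eq_or_lt with rfl | hB
  · have : {ω | t < X ω} = ∅ := by
      ext ω
      simpa using (by simpa using hXY ω : X ω ≤ 0).trans ht.le
    rw [this, measureReal_empty, mul_zero]
    positivity
  · calc t ^ α * P.real {ω | t < X ω} ≤ t ^ α * P.real {ω | t / B < Y ω} := by
          gcongr ?_ * ?_
          refine measureReal_mono fun ω hω => ?_
          have h1 : t < X ω := hω
          exact (div_lt_iff₀' hB).2 (h1.trans_le (hXY ω))
      _ = B ^ α * ((t / B) ^ α * P.real {ω | t / B < Y ω}) := by
          rw [Real.div_rpow ht.le hB.le, ← mul_assoc,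
            mul_div_cancel₀ _ (Real.rpow_pos_of_pos hB α).ne']
      _ ≤ B ^ α * M := by
          gcongr
          exact hM _ (by positivity)

/-- Tail of a random seminorm of an independent vector, by conditioning on the random matrix and
dominated convergence. The dominating function comes from the tail of the sup norm of `V`. -/
theorem hasParetoTail_seminorm_mulVec (hα : 0 < α) [IsProbabilityMeasure P] (hV : Measurable V)
    (hA : Measurable fun ω i j => A ω i j)
    (hindep : IndepFun (fun ω (i : Fin q) (j : Fin d) => A ω i j) V P)
    (hAp : ∀ i j, MemLp (fun ω => A ω i j) (ENNReal.ofReal α) P)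
    (N : Seminorm ℝ (Fin q → ℝ)) {c : Seminorm ℝ (Fin d → ℝ) → ℝ}
    (hc : ∀ ψ : Seminorm ℝ (Fin d → ℝ), HasParetoTail P α (fun ω => ψ (V ω)) (c ψ)) :
    HasParetoTail P α (fun ω => N ((A ω).mulVec (V ω)))
      (∫ ω, c (N.comp (A ω).mulVecLin) ∂P) := by
  obtain ⟨M, hM0, hM⟩ := (hc (normSeminorm ℝ (Fin d → ℝ))).exists_bound hα
  have hS : ∀ t : ℝ, MeasurableSet {p : (Fin q → Fin d → ℝ) × (Fin d → ℝ) |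
      t < N ((Matrix.of p.1).mulVec p.2)} := fun t =>
    measurableSet_lt measurable_const (measurable_seminorm_mulVec N)
  have hsec : ∀ (t : ℝ) (a : Fin q → Fin d → ℝ),
      P.map V (Prod.mk a ⁻¹' {p : (Fin q → Fin d → ℝ) × (Fin d → ℝ) |
        t < N ((Matrix.of p.1).mulVec p.2)}) =
      P {ω | t < N ((Matrix.of a).mulVec (V ω))} := fun t a => by
    rw [Measure.map_apply hV (measurable_prodMk_left (hS t))]
    rfl
  have hsecm : ∀ t : ℝ, Measurable fun a : Fin q → Fin d → ℝ =>
      P {ω | t < N ((Matrix.of a).mulVec (V ω))} := fun t => by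
    simp only [← hsec]
    exact measurable_measure_prodMk_left (hS t)
  have hcond : ∀ t : ℝ, P.real {ω | t < N ((A ω).mulVec (V ω))} =
      ∫ ω, P.real {ω' | t < N ((A ω).mulVec (V ω'))} ∂P := by
    intro t
    have hprod := (indepFun_iff_map_prod_eq_prod_map_map hA.aemeasurable hV.aemeasurable).1 hindep
    have h1 : P {ω | t < N ((A ω).mulVec (V ω))} =
        ∫⁻ ω, P {ω' | t < N ((A ω).mulVec (V ω'))} ∂P := by
      calc P {ω | t < N ((A ω).mulVec (V ω))}
          = P.map (fun ω => ((fun i j => A ω i j), V ω))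
              {p : (Fin q → Fin d → ℝ) × (Fin d → ℝ) |
                t < N ((Matrix.of p.1).mulVec p.2)} := by
            rw [Measure.map_apply (hA.prodMk hV) (hS t)]
            rfl
        _ = ∫⁻ a, P {ω | t < N ((Matrix.of a).mulVec (V ω))}
              ∂(P.map fun ω i j => A ω i j) := by
            rw [hprod, Measure.prod_apply (hS t)]
            simp only [hsec]
        _ = _ := lintegral_map (hsecm t) hA
    rw [measureReal_def, h1, ← integral_toReal]
    · rfl
    · exact ((hsecm t).comp hA).aemeasurable
    · exact ae_of_all _ fun ω => measure_lt_top _ _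
  have hcoef : MemLp (fun ω => ∑ j, N ((A ω).mulVec (Pi.single j 1))) (ENNReal.ofReal α) P :=
    memLp_finsetSum Finset.univ (f := fun j ω => N ((A ω).mulVec (Pi.single j 1)))
      fun j _ => memLp_seminorm_mulVec hA hAp N _
  have hcoef0 : ∀ ω, 0 ≤ ∑ j, N ((A ω).mulVec (Pi.single j 1)) := fun ω =>
    Finset.sum_nonneg fun j _ => apply_nonneg N _
  have hdom := (integrable_rpow_of_memLp hα hcoef hcoef0).mul_const M
  unfold HasParetoTail
  simp only [hcond, ← integral_const_mul]
  refine tendsto_integral_filter_of_dominated_convergence _ (.of_forall fun t => ?_) ?_ hdom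
    (ae_of_all _ fun ω => hc (N.comp (A ω).mulVecLin))
  · exact ((((hsecm t).comp hA).ennreal_toReal).const_mul _).aestronglyMeasurable
  · filter_upwards [eventually_gt_atTop 0] with t ht
    refine ae_of_all _ fun ω => ?_
    rw [Real.norm_of_nonneg (by positivity)]
    exact tail_le_of_le_mul (hcoef0 ω) hM0 hM
      (fun ω' => seminorm_le_mul_norm (N.comp (A ω).mulVecLin) (V ω')) ht

end RandomMatrix

/-! ### Exposures -/

theorem fullLoad_eq {Ω : Type*} {q d : ℕ} {α : ℝ} {K : Fin d → ℝ}
    {A : Ω → Matrix (Fin q) (Fin d) ℝ} (ω : Ω) :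
    fullLoad α K A ω = (A ω).mulVec (fun j => K j ^ (1 / α)) := by
  rw [fullLoad, ← Matrix.mulVec_mulVec]
  congr 1
  ext j
  simp [Matrix.mulVec_diagonal]

section Exposures

variable {Ω : Type*} [MeasurableSpace Ω] {P : Measure Ω} {q d : ℕ} {V : Ω → Fin d → ℝ} {α : ℝ}
  {A : Ω → Matrix (Fin q) (Fin d) ℝ} {K : Fin d → ℝ}

theorem hasParetoTail_of_asympEq {X : Ω → ℝ} {c : ℝ} (hc : 0 < c)
    (h : AsympEq atTop (fun t : ℝ => P.real {ω | t < X ω}) (fun t => c * t ^ (-α))) :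
    HasParetoTail P α X c := by
  have h1 := Tendsto.const_mul c h
  rw [mul_one] at h1
  refine h1.congr' ?_
  filter_upwards [eventually_gt_atTop 0] with t ht
  rw [Real.rpow_neg ht.le]
  have : 0 < t ^ α := by positivity
  field_simp

/-- The seminorm `x ↦ |x i|`. It turns the exposure of one agent into a special case of the
aggregated exposure. -/
noncomputable def coordSeminorm (i : Fin q) : Seminorm ℝ (Fin q → ℝ) :=
  (normSeminorm ℝ ℝ).comp (LinearMap.proj i)

theorem coordSeminorm_apply (i : Fin q) (x : Fin q → ℝ) : coordSeminorm i x = |x i| := rfl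

theorem coordSeminorm_mulVec (i : Fin q) {a : Matrix (Fin q) (Fin d) ℝ} (ha : ∀ i j, 0 ≤ a i j)
    {v : Fin d → ℝ} (hv : ∀ j, 0 ≤ v j) : coordSeminorm i (a.mulVec v) = a.mulVec v i := by
  rw [coordSeminorm_apply]
  have h : 0 ≤ ∑ j, a i j * v j := Finset.sum_nonneg fun j _ => mul_nonneg (ha i j) (hv j)
  exact abs_of_nonneg h

theorem CIndSystem_coordSeminorm (hA0 : ∀ ω i j, 0 ≤ A ω i j) (i : Fin q) :
    CIndSystem P α K (coordSeminorm i) A = CIndAgent P α K A i := by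
  simp only [CIndSystem, CIndAgent, coordSeminorm_apply, Matrix.mulVec_single_one, Matrix.col_apply,
    abs_of_nonneg (hA0 _ _ _)]

theorem CDepSystem_coordSeminorm (hA0 : ∀ ω i j, 0 ≤ A ω i j) (hK : ∀ j, 0 < K j) (i : Fin q) :
    CDepSystem P α K (coordSeminorm i) A = CDepAgent P α K A i := by
  simp only [CDepSystem, CDepAgent, fullLoad_eq,
    coordSeminorm_mulVec i (hA0 _) fun j => (Real.rpow_pos_of_pos (hK j) (1 / α)).le]

theorem integral_rpow_pos {f : Ω → ℝ} (hint : Integrable (fun ω => f ω ^ α) P)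
    (hf0 : ∀ ω, 0 ≤ f ω) (hpos : P {ω | 0 < f ω} ≠ 0) : 0 < ∫ ω, f ω ^ α ∂P := by
  rw [integral_pos_iff_support_of_nonneg (fun ω => Real.rpow_nonneg (hf0 ω) α) hint]
  refine (pos_iff_ne_zero.2 hpos).trans_le (measure_mono fun ω hω => ?_)
  exact (Real.rpow_pos_of_pos hω α).ne'

variable [IsProbabilityMeasure P] {ν : Measure (PuncturedOrthant d)}

theorem ConcentratedOnAxes.tailRiskAsymptotics (hα : 1 < α) (hax : ConcentratedOnAxes ν)
    (hν : IsExponentMeasure P V (fun n : ℕ => (n : ℝ) ^ (1 / α)) ν)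
    (hV : Measurable V) (hV0 : ∀ ω j, 0 ≤ V ω j) (hK : ∀ j, 0 < K j)
    (htail : ∀ j, HasParetoTail P α (fun ω => V ω j) (K j))
    (hA : Measurable fun ω i j => A ω i j)
    (hindep : IndepFun (fun ω (i : Fin q) (j : Fin d) => A ω i j) V P)
    (hAp : ∀ i j, MemLp (fun ω => A ω i j) (ENNReal.ofReal α) P) (N : Seminorm ℝ (Fin q → ℝ))
    (hpos : P {ω | ∃ j, 0 < N ((A ω).mulVec (Pi.single j 1))} ≠ 0) :
    TailRiskAsymptotics P α (fun ω => N (exposure A V ω)) (CIndSystem P α K N A) := by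
  have hα0 : 0 < α := by linarith
  have hint : ∀ j, Integrable (fun ω => N ((A ω).mulVec (Pi.single j 1)) ^ α) P := fun j =>
    integrable_rpow_of_memLp hα0 (memLp_seminorm_mulVec hA hAp N _) fun ω => apply_nonneg N _
  have hnn : ∀ j, 0 ≤ ∫ ω, N ((A ω).mulVec (Pi.single j 1)) ^ α ∂P := fun j =>
    integral_nonneg fun ω => Real.rpow_nonneg (apply_nonneg N _) α
  have hC : 0 < CIndSystem P α K N A := by
    obtain ⟨j, hj⟩ : ∃ j, P {ω | 0 < N ((A ω).mulVec (Pi.single j 1))} ≠ 0 := by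
      by_contra! hcon
      refine hpos ?_
      rw [Set.ofPred_exists]
      exact measure_iUnion_null hcon
    exact Finset.sum_pos' (fun k _ => mul_nonneg (hK k).le (hnn k)) ⟨j, Finset.mem_univ j,
      mul_pos (hK j) (integral_rpow_pos (hint j) (fun ω => apply_nonneg N _) hj)⟩
  refine HasParetoTail.tailRiskAsymptotics hα
    ((measurable_seminorm_mulVec N).comp (hA.prodMk hV)) hC ?_
  have h := hasParetoTail_seminorm_mulVec hα0 hV hA hindep hAp N
    (hax.seminorm_tail hα0 hν hV hV0 htail)
  have hval : ∫ ω, ∑ j, (N.comp (A ω).mulVecLin) (Pi.single j 1) ^ α * K j ∂P =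
      CIndSystem P α K N A := by
    have h1 := integral_finsetSum Finset.univ fun j (_ : j ∈ Finset.univ) =>
      (hint j).mul_const (K j)
    refine h1.trans (Finset.sum_congr rfl fun j _ => ?_)
    rw [integral_mul_const, mul_comm]
  rwa [hval] at h

theorem ConcentratedOnRay.tailRiskAsymptotics (hα : 1 < α) (hray : ConcentratedOnRay α K ν)
    (hν : IsExponentMeasure P V (fun n : ℕ => (n : ℝ) ^ (1 / α)) ν)
    (hV : Measurable V) (hV0 : ∀ ω j, 0 ≤ V ω j) (hK : ∀ j, 0 < K j)
    (htail : ∀ j, HasParetoTail P α (fun ω => V ω j) (K j))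
    (hA : Measurable fun ω i j => A ω i j)
    (hindep : IndepFun (fun ω (i : Fin q) (j : Fin d) => A ω i j) V P)
    (hAp : ∀ i j, MemLp (fun ω => A ω i j) (ENNReal.ofReal α) P) (N : Seminorm ℝ (Fin q → ℝ))
    (hpos : P {ω | 0 < N (fullLoad α K A ω)} ≠ 0) :
    TailRiskAsymptotics P α (fun ω => N (exposure A V ω)) (CDepSystem P α K N A) := by
  have hα0 : 0 < α := by linarith
  have hC : 0 < CDepSystem P α K N A := by
    refine integral_rpow_pos (integrable_rpow_of_memLp hα0 ?_ fun ω => apply_nonneg N _)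
      (fun ω => apply_nonneg N _) hpos
    simp only [fullLoad_eq]
    exact memLp_seminorm_mulVec hA hAp N _
  refine HasParetoTail.tailRiskAsymptotics hα
    ((measurable_seminorm_mulVec N).comp (hA.prodMk hV)) hC ?_
  have h := hasParetoTail_seminorm_mulVec hα0 hV hA hindep hAp N
    (hray.seminorm_tail hα0 hK hν hV hV0 htail)
  have hval : ∫ ω, (N.comp (A ω).mulVecLin) (fun j => K j ^ (1 / α)) ^ α ∂P =
      CDepSystem P α K N A := by
    simp only [CDepSystem, fullLoad_eq]
    rfl
  rwa [hval] at h

end Exposures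

end InsuranceMarket

theorem corollary3p8 {Ω : Type*} [MeasurableSpace Ω] (P : Measure Ω) [IsProbabilityMeasure P]
    (q d : ℕ) (α : ℝ) (hα : 1 < α)
    -- claims: nonnegative, with Pareto tails
    (V : Ω → Fin d → ℝ) (hVmeas : Measurable V) (hVnonneg : ∀ ω j, 0 ≤ V ω j)
    (K : Fin d → ℝ) (hK : ∀ j, 0 < K j)
    (hPareto : ∀ j, InsuranceMarket.AsympEq atTop
      (fun t : ℝ => P.real {ω | t < V ω j}) (fun t => K j * t ^ (-α)))
    -- random bipartite graph and random weights
    (G : Fin q → Fin d → Set Ω) (hGmeas : ∀ i j, MeasurableSet (G i j))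
    (W : Fin q → Fin d → Ω → ℝ) (hWmeas : ∀ i j, Measurable (W i j))
    (hWnonneg : ∀ i j ω, 0 ≤ W i j ω)
    (A : Ω → Matrix (Fin q) (Fin d) ℝ) (hA : A = InsuranceMarket.adjMatrix G W)
    (hmoment : ∀ i j, Integrable (fun ω => A ω i j ^ α) P)
    (hindep : IndepFun (fun ω (i : Fin q) (j : Fin d) => A ω i j) V P)
    -- multivariate regular variation of the claims
    (ν : Measure (InsuranceMarket.PuncturedOrthant d))
    (hν : InsuranceMarket.IsExponentMeasure P V (fun n : ℕ => (n : ℝ) ^ (1 / α)) ν)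
    -- the norm that aggregates the exposures
    (N : Seminorm ℝ (Fin q → ℝ)) (hNdef : ∀ x, N x = 0 → x = 0)
    (hNunit : ∀ i, N (Pi.single i 1) = 1) :
    (InsuranceMarket.ConcentratedOnAxes ν →
      (∀ i, P {ω | ∃ j, 0 < A ω i j} ≠ 0 →
        InsuranceMarket.TailRiskAsymptotics P α
          (fun ω => InsuranceMarket.exposure A V ω i)
          (InsuranceMarket.CIndAgent P α K A i)) ∧
      (P {ω | ∃ i j, 0 < A ω i j} ≠ 0 →
        InsuranceMarket.TailRiskAsymptotics P α
          (fun ω => N (InsuranceMarket.exposure A V ω))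
          (InsuranceMarket.CIndSystem P α K N A))) ∧
    (InsuranceMarket.ConcentratedOnRay α K ν →
      (∀ i, P {ω | ∃ j, 0 < A ω i j} ≠ 0 →
        InsuranceMarket.TailRiskAsymptotics P α
          (fun ω => InsuranceMarket.exposure A V ω i)
          (InsuranceMarket.CDepAgent P α K A i)) ∧
      (P {ω | ∃ i j, 0 < A ω i j} ≠ 0 →
        InsuranceMarket.TailRiskAsymptotics P α
          (fun ω => N (InsuranceMarket.exposure A V ω))
          (InsuranceMarket.CDepSystem P α K N A))) := by
  have hα0 : 0 < α := by linarith
  have hA0 : ∀ ω i j, 0 ≤ A ω i j := fun ω i j => by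
    rw [hA]
    exact Set.indicator_nonneg (fun ω _ => hWnonneg i j ω) ω
  have hAm : Measurable fun ω i j => A ω i j := by
    refine measurable_pi_lambda _ fun i => measurable_pi_lambda _ fun j => ?_
    rw [hA]
    exact (hWmeas i j).indicator (hGmeas i j)
  have hAij : ∀ i j, Measurable fun ω => A ω i j := fun i j =>
    (measurable_pi_apply j).comp ((measurable_pi_apply i).comp hAm)
  have hAp : ∀ i j, MemLp (fun ω => A ω i j) (ENNReal.ofReal α) P := fun i j => by
    rw [← integrable_norm_rpow_iff (hAij i j).aestronglyMeasurable (by simpa using hα0)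
      ENNReal.ofReal_ne_top, ENNReal.toReal_ofReal hα0.le]
    simpa only [Real.norm_of_nonneg (hA0 _ i j)] using hmoment i j
  have htail := fun j => InsuranceMarket.hasParetoTail_of_asympEq (hK j) (hPareto j)
  have hk : ∀ j, 0 < K j ^ (1 / α) := fun j => Real.rpow_pos_of_pos (hK j) _
  have hexp : ∀ i, (fun ω => InsuranceMarket.exposure A V ω i) =
      fun ω => InsuranceMarket.coordSeminorm i (InsuranceMarket.exposure A V ω) := fun i =>
    funext fun ω => (InsuranceMarket.coordSeminorm_mulVec i (hA0 ω) (hVnonneg ω)).symm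
  have hcol : ∀ ω i j, 0 < A ω i j → 0 < (A ω).mulVec (Pi.single j 1) i := fun ω i j h => by
    simpa using h
  have hload : ∀ ω i j, 0 < A ω i j → 0 < InsuranceMarket.fullLoad α K A ω i := fun ω i j h => by
    rw [InsuranceMarket.fullLoad_eq]
    exact Finset.sum_pos' (fun l _ => mul_nonneg (hA0 ω i l) (hk l).le)
      ⟨j, Finset.mem_univ j, mul_pos h (hk j)⟩
  have hNpos : ∀ (x : Fin q → ℝ) (i : Fin q), 0 < x i → 0 < N x := fun x i hx =>
    (apply_nonneg N x).lt_of_ne fun h0 => hx.ne' (congrFun (hNdef x h0.symm) i)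
  have hmono : ∀ {s t : Set Ω}, P s ≠ 0 → s ⊆ t → P t ≠ 0 := fun hs hst ht =>
    hs (measure_mono_null hst ht)
  refine ⟨fun hax => ⟨fun i hi => ?_, fun h => ?_⟩, fun hray => ⟨fun i hi => ?_, fun h => ?_⟩⟩
  · rw [hexp, ← InsuranceMarket.CIndSystem_coordSeminorm hA0]
    refine hax.tailRiskAsymptotics hα hν hVmeas hVnonneg hK htail hAm hindep hAp _ (hmono hi ?_)
    rintro ω ⟨j, hj⟩
    exact ⟨j, abs_pos_of_pos (hcol ω i j hj)⟩
  · refine hax.tailRiskAsymptotics hα hν hVmeas hVnonneg hK htail hAm hindep hAp N (hmono h ?_)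
    rintro ω ⟨i, j, hj⟩
    exact ⟨j, hNpos _ i (hcol ω i j hj)⟩
  · rw [hexp, ← InsuranceMarket.CDepSystem_coordSeminorm hA0 hK]
    refine hray.tailRiskAsymptotics hα hν hVmeas hVnonneg hK htail hAm hindep hAp _ (hmono hi ?_)
    rintro ω ⟨j, hj⟩
    exact abs_pos_of_pos (hload ω i j hj)
  · refine hray.tailRiskAsymptotics hα hν hVmeas hVnonneg hK htail hAm hindep hAp N (hmono h ?_)
    rintro ω ⟨i, j, hj⟩
    exact hNpos _ i (hload ω i j hj)
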